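/- **Setting.** Fix a set of atomic propositions. Classical logic *structures* are generated by $R ::= \mathsf{f} \mid \mathsf{t} \mid a \mid (R\lor R) \mid (R\land R) \mid \overline{R}$, where $a$ is an atomic proposition and $\mathsf f,\mathsf t$ are the units false and true. They are considered modulo the smallest congruence $\approx$ given by associativity and commutativity of $\lor$ and $\land$ and the De Morgan equations $\overline{R\lor T}\approx\overline R\land\overline T$, $\overline{R\land T}\approx\overline R\lor\overline T$, $\overline{\overline R}\approx R$, $\overline{\mathsf f}\approx\mathsf t$, $\overline{\mathsf t}\approx\mathsf f$. Atoms are the atomic propositions, their negations, and the two units; $\mathrm{at}\,R$ is the set of atoms occurring in the negation normal form of $R$. A context $S\{\ \}$ is a structure with one hole that is not in the scope of a negation. A rule instance $Q \leftarrow Q'$ allows one to pass, for every context $S\{\ \}$, from the conclusion $S\{Q\}$ (bottom) to the premise $S\{Q'\}$ (top), modulo $\approx$. The system $\mathsf{KSu}$ consists of the rules $$\mathsf{ai}{\downarrow}:\ (a\lor\overline a)\leftarrow\mathsf t,\qquad \mathsf{s}:\ (U\lor(R\land T))\leftarrow((U\lor R)\land T),\qquad \mathsf{w}{\downarrow}:\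 R\leftarrow\mathsf f,\qquad \mathsf{c}{\downarrow}:\ R\leftarrow(R\lor R),$$ $$\mathsf{u}_1{\downarrow}:\ (R\lor\mathsf f)\leftarrow R,\qquad \mathsf{u}_2{\downarrow}:\ (R\land\mathsf t)\leftarrow R,\qquad \mathsf{u}_3{\downarrow}:\ (\mathsf t\lor\mathsf t)\leftarrow\mathsf t,\qquad \mathsf{u}_4{\downarrow}:\ (\mathsf f\land\mathsf f)\leftarrow\mathsf f,$$ with $a$ an atomic proposition and $R,T,U$ arbitrary structures. An instance of the switch rule $\mathsf s$ as displayed is * *interaction* if $\mathrm{at}\,\overline R\cap\mathrm{at}\,U\neq\emptyset$; * *lazy* if $U$ is a conjunction or an atom different from $\mathsf f$; * *deep* if $R$ is a disjunction or an atom different from $\mathsf t$. The *deep lazy interaction switch* $\mathsf{dlis}$ is the switch rule restricted to instances that satisfy all three conditions. $\mathsf{KSdli}$ is the system obtained from $\mathsf{KSu}$ by replacing $\mathsf s$ with $\mathsf{dlis}$. Likewise $\mathsf{KSd}$, $\mathsf{KSl}$, $\mathsf{KSi}$, $\mathsf{KSdi}$, $\mathsf{KSli}$, $\mathsf{KSdl}$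 are obtained by imposing on $\mathsf s$ exactly the conditions named by the letters $\mathsf d$ (deep), $\mathsf l$ (lazy), $\mathsf i$ (interaction). A *proof* of $R$ in a system is a finite, possibly empty, chain of instances of its rules with conclusion $R$ and premise $\mathsf t$. Two systems are *equivalent* if they prove the same structures. **Theorem.** The systems $\mathsf{KSu}$ and $\mathsf{KSdli}$ are equivalent. Moreover, all eight systems $\mathsf{KSu}$, $\mathsf{KSd}$, $\mathsf{KSl}$, $\mathsf{KSi}$, $\mathsf{KSdi}$, $\mathsf{KSli}$, $\mathsf{KSdl}$ and $\mathsf{KSdli}$ are equivalent to one another. -/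

import Mathlib

namespace KS

/-- Structures of classical logic over the set `α` of atomic propositions. -/
inductive Structure (α : Type*) where
  | fls : Structure α
  | tru : Structure α
  | atom : α → Structure α
  | disj : Structure α → Structure α → Structure α
  | conj : Structure α → Structure α → Structure α
  | neg : Structure α → Structure α

open Structure

/-- The congruence `≈` on structures: the smallest congruence containing associativity and
commutativity of disjunction and conjunction and the De Morgan equations for negation. -/
inductive Congr {α : Type*} : Structure α → Structure α → Prop where
  | refl (R : Structure α) : Congr R R
  | symm {R T : Structure α} : Congr R T → Congr T R
  | trans {R T U : Structure α} : Congr R T → Congr T U → Congr R U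
  | congr_disj {R R' T T' : Structure α} :
      Congr R R' → Congr T T' → Congr (disj R T) (disj R' T')
  | congr_conj {R R' T T' : Structure α} :
      Congr R R' → Congr T T' → Congr (conj R T) (conj R' T')
  | congr_neg {R R' : Structure α} : Congr R R' → Congr (neg R) (neg R')
  | disj_assoc (R T U : Structure α) : Congr (disj (disj R T) U) (disj R (disj T U))
  | conj_assoc (R T U : Structure α) : Congr (conj (conj R T) U) (conj R (conj T U))
  | disj_comm (R T : Structure α) : Congr (disj R T) (disj T R)
  | conj_comm (R T : Structure α) : Congr (conj R T) (conj T R)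
  | neg_disj (R T : Structure α) : Congr (neg (disj R T)) (conj (neg R) (neg T))
  | neg_conj (R T : Structure α) : Congr (neg (conj R T)) (disj (neg R) (neg T))
  | neg_neg (R : Structure α) : Congr (neg (neg R)) R
  | neg_fls : Congr (neg fls) tru
  | neg_tru : Congr (neg tru) fls

/-- Structure contexts: structures with one hole, not in the scope of a negation. -/
inductive Context (α : Type*) where
  | hole : Context α
  | disjLeft : Context α → Structure α → Context α
  | disjRight : Structure α → Context α → Context α
  | conjLeft : Context α → Structure α → Context α
  | conjRight : Structure α → Context α → Context α

/-- `S.fill R` is the structure `S{R}`. -/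
def Context.fill {α : Type*} : Context α → Structure α → Structure α
  | .hole, R => R
  | .disjLeft S T, R => disj (S.fill R) T
  | .disjRight T S, R => disj T (S.fill R)
  | .conjLeft S T, R => conj (S.fill R) T
  | .conjRight T S, R => conj T (S.fill R)

/-- Atoms: atomic propositions, their negations, and the two units as special atoms. -/
inductive Atom (α : Type*) where
  | pos : α → Atom α
  | neg : α → Atom α
  | fls : Atom α
  | tru : Atom α

/-- The complementary atom. -/
def Atom.dual {α : Type*} : Atom α → Atom α
  | .pos a => .neg a
  | .neg a => .pos a
  | .fls => .tru
  | .tru => .fls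

/-- An atom as a structure. -/
def Atom.toStructure {α : Type*} : Atom α → Structure α
  | .pos a => Structure.atom a
  | .neg a => Structure.neg (Structure.atom a)
  | .fls => Structure.fls
  | .tru => Structure.tru

/-- `at R`, the set of the atoms in (the negation normal form of) `R`. -/
def atoms {α : Type*} : Structure α → Set (Atom α)
  | .fls => {Atom.fls}
  | .tru => {Atom.tru}
  | .atom a => {Atom.pos a}
  | .disj R T => atoms R ∪ atoms T
  | .conj R T => atoms R ∪ atoms T
  | .neg R => Atom.dual '' atoms R

/-- `at R` does not depend on the representative of `R` modulo `≈`. -/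
theorem atoms_congr {α : Type*} {R T : Structure α} (h : Congr R T) : atoms R = atoms T := by
  have dd : ∀ x : Atom α, x.dual.dual = x := by intro x; cases x <;> rfl
  induction h with
  | refl => rfl
  | symm _ ih => exact ih.symm
  | trans _ _ ih₁ ih₂ => exact ih₁.trans ih₂
  | congr_disj _ _ ih₁ ih₂ => simp [atoms, ih₁, ih₂]
  | congr_conj _ _ ih₁ ih₂ => simp [atoms, ih₁, ih₂]
  | congr_neg _ ih => simp [atoms, ih]
  | disj_assoc => simp [atoms, Set.union_assoc]
  | conj_assoc => simp [atoms, Set.union_assoc]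
  | disj_comm => simp [atoms, Set.union_comm]
  | conj_comm => simp [atoms, Set.union_comm]
  | neg_disj => simp [atoms, Set.image_union]
  | neg_conj => simp [atoms, Set.image_union]
  | neg_neg => simp [atoms, Set.image_image, dd]
  | neg_fls => simp [atoms, Atom.dual]
  | neg_tru => simp [atoms, Atom.dual]

/-- `at (¬R) ∩ at U ≠ ∅`: `R` and `U` contain complementary atoms. -/
def Interact {α : Type*} (R U : Structure α) : Prop :=
  (atoms (neg R) ∩ atoms U).Nonempty

/-- `R`, read modulo `≈`, is a disjunction. -/
def IsDisj {α : Type*} (R : Structure α) : Prop :=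
  ∃ A B : Structure α, Congr R (disj A B)

/-- `R`, read modulo `≈`, is a conjunction. -/
def IsConj {α : Type*} (R : Structure α) : Prop :=
  ∃ A B : Structure α, Congr R (conj A B)

/-- `R`, read modulo `≈`, is an atom different from the atom `x`. -/
def IsAtomNe {α : Type*} (R : Structure α) (x : Atom α) : Prop :=
  ∃ y : Atom α, y ≠ x ∧ Congr R y.toStructure

/-- A rule is the relation between the redexes (first argument, in the conclusion) and the
contracta (second argument, in the premise) of its instances. -/
abbrev Rule (α : Type*) := Structure α → Structure α → Prop

/-- Atomic interaction. -/
inductive Rule.ai {α : Type*} : Rule α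
  | mk (a : α) : Rule.ai (disj (atom a) (neg (atom a))) tru

/-- Switch. -/
inductive Rule.switch {α : Type*} : Rule α
  | mk (U R T : Structure α) : Rule.switch (disj U (conj R T)) (conj (disj U R) T)

/-- Weakening. -/
inductive Rule.weak {α : Type*} : Rule α
  | mk (R : Structure α) : Rule.weak R fls

/-- Contraction. -/
inductive Rule.contr {α : Type*} : Rule α
  | mk (R : Structure α) : Rule.contr R (disj R R)

/-- Unit one. -/
inductive Rule.u1 {α : Type*} : Rule α
  | mk (R : Structure α) : Rule.u1 (disj R fls) R

/-- Unit two. -/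
inductive Rule.u2 {α : Type*} : Rule α
  | mk (R : Structure α) : Rule.u2 (conj R tru) R

/-- Unit three. -/
inductive Rule.u3 {α : Type*} : Rule α
  | mk : Rule.u3 (disj tru tru) tru

/-- Unit four. -/
inductive Rule.u4 {α : Type*} : Rule α
  | mk : Rule.u4 (conj fls fls) fls

/-- The three restrictions that can be imposed on the switch rule. -/
inductive Restriction where
  | interaction
  | lazy
  | deep

/-- What a restriction demands of the structures `U` and `R` in an instance of switch with redex
`U ∨ (R ∧ T)` and contractum `(U ∨ R) ∧ T`. -/
def Restriction.Holds {α : Type*} (U R : Structure α) : Restriction → Prop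
  | .interaction => Interact R U
  | .lazy => IsConj U ∨ IsAtomNe U Atom.fls
  | .deep => IsDisj R ∨ IsAtomNe R Atom.tru

/-- The switch rule subject to all restrictions in `c`. -/
inductive Rule.restrictedSwitch {α : Type*} (c : Set Restriction) : Rule α
  | mk (U R T : Structure α) (h : ∀ r ∈ c, r.Holds U R) :
      Rule.restrictedSwitch c (disj U (conj R T)) (conj (disj U R) T)

/-- Deep lazy interaction switch. -/
def Rule.dlis {α : Type*} : Rule α :=
  Rule.restrictedSwitch {Restriction.deep, Restriction.lazy, Restriction.interaction}

/-- A system is a set of rules. -/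
abbrev System (α : Type*) := Set (Rule α)

/-- One bottom-up rule instance in `𝒮`: conclusion `S{Q}` and premise `S{Q'}`, modulo `≈`, where
`Q` is the redex and `Q'` the contractum of an instance of a rule of `𝒮`. -/
def Step {α : Type*} (𝒮 : System α) (concl prem : Structure α) : Prop :=
  ∃ ρ ∈ 𝒮, ∃ (S : Context α) (Q Q' : Structure α),
    ρ Q Q' ∧ Congr concl (S.fill Q) ∧ Congr prem (S.fill Q')

/-- `R` has a proof in `𝒮`: a finite (possibly empty) chain of rule instances with conclusion `R`
whose premise is, modulo `≈`, the unit true. -/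
def Proves {α : Type*} (𝒮 : System α) (R : Structure α) : Prop :=
  ∃ T : Structure α, Relation.ReflTransGen (Step 𝒮) R T ∧ Congr T tru

/-- Two systems are equivalent if they prove the same structures. -/
def Equivalent {α : Type*} (𝒮 𝒮' : System α) : Prop :=
  ∀ R : Structure α, Proves 𝒮 R ↔ Proves 𝒮' R

/-- The deep inference system `KSu` for classical logic. -/
def KSu (α : Type*) : System α :=
  {Rule.ai, Rule.switch, Rule.weak, Rule.contr, Rule.u1, Rule.u2, Rule.u3, Rule.u4}

/-- The system obtained from `KSu` by replacing the switch rule with the rule `ρ`. -/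
def KSreplace {α : Type*} (ρ : Rule α) : System α :=
  {Rule.ai, ρ, Rule.weak, Rule.contr, Rule.u1, Rule.u2, Rule.u3, Rule.u4}

/-- `KSu` with deep lazy interaction switch. -/
def KSdli (α : Type*) : System α := KSreplace Rule.dlis

/-- `KSu` with deep switch. -/
def KSd (α : Type*) : System α := KSreplace (Rule.restrictedSwitch {Restriction.deep})

/-- `KSu` with lazy switch. -/
def KSl (α : Type*) : System α := KSreplace (Rule.restrictedSwitch {Restriction.lazy})

/-- `KSu` with interaction switch. -/
def KSi (α : Type*) : System α := KSreplace (Rule.restrictedSwitch {Restriction.interaction})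

/-- `KSu` with deep interaction switch. -/
def KSdi (α : Type*) : System α :=
  KSreplace (Rule.restrictedSwitch {Restriction.deep, Restriction.interaction})

/-- `KSu` with lazy interaction switch. -/
def KSli (α : Type*) : System α :=
  KSreplace (Rule.restrictedSwitch {Restriction.lazy, Restriction.interaction})

/-- `KSu` with deep lazy switch. -/
def KSdl (α : Type*) : System α :=
  KSreplace (Rule.restrictedSwitch {Restriction.deep, Restriction.lazy})

/-- The eight systems `KSu`, `KSd`, `KSl`, `KSi`, `KSdi`, `KSli`, `KSdl` and `KSdli`. -/
def KSfamily (α : Type*) : Set (System α) :=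
  {KSu α, KSd α, KSl α, KSi α, KSdi α, KSli α, KSdl α, KSdli α}

end KS

namespace KS

open Structure

variable {α : Type*}

/-! ### Truth values and soundness -/

/-! Each of the eight systems proves exactly the tautologies. Soundness is immediate: every rule
passes truth from premise to conclusion. As `dlis` is an instance of every switch rule considered,
completeness is needed only for `KSdli`.

A tautology is put in negation normal form and kept as a list read disjunctively, with induction on
its size (`Der.of_taut`). Disjunctions are flattened, and a list of literals is closed by `t` or by
a complementary pair. For `(A ∧ B) ∨ Δ` with `Δ` not a tautology, contraction duplicates `Δ`: one
copy is spent proving `A`, and the other stays with `B`.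

Spending a copy without violating the restrictions is the crux (`Der.absorb`). Members of `Δ` are
switched in one at a time, next to `A`. As long as the growing conjunct is not a tautology, some
remaining member interacts with it, for otherwise two refuting valuations could be glued together
(`exists_interact`). Once it is a tautology, the rest of the copy is weakened away and the induction
hypothesis proves the conjunct. -/

/-- The truth value of a structure under a valuation. -/
def Structure.eval (v : α → Prop) : Structure α → Prop
  | .fls => False
  | .tru => True
  | .atom a => v a
  | .disj R T => R.eval v ∨ T.eval v
  | .conj R T => R.eval v ∧ T.eval v
  | .neg R => ¬ R.eval v

theorem Congr.eval_iff {R T : Structure α} (h : Congr R T) (v : α → Prop) :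
    R.eval v ↔ T.eval v := by
  induction h with
  | refl => rfl
  | symm _ ih => exact ih.symm
  | trans _ _ ih₁ ih₂ => exact ih₁.trans ih₂
  | _ => simp only [Structure.eval] at *; tauto

/-- The hole is never under a negation, so contexts are monotone in truth. -/
theorem Context.eval_mono (v : α → Prop) {Q Q' : Structure α} (h : Q'.eval v → Q.eval v)
    (S : Context α) : (S.fill Q').eval v → (S.fill Q).eval v := by
  induction S <;> simp only [Context.fill, Structure.eval] <;> tauto

/-- A rule is sound if truth passes from its contracta to its redexes. -/
def Rule.Sound (ρ : Rule α) : Prop :=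
  ∀ (v : α → Prop) (Q Q' : Structure α), ρ Q Q' → Q'.eval v → Q.eval v

theorem Proves.eval {𝒮 : System α} (h𝒮 : ∀ ρ ∈ 𝒮, ρ.Sound) {R : Structure α}
    (h : Proves 𝒮 R) (v : α → Prop) : R.eval v := by
  obtain ⟨T, hRT, hT⟩ := h
  induction hRT using Relation.ReflTransGen.head_induction_on with
  | refl => exact (hT.eval_iff v).2 trivial
  | head hs _ ih =>
    obtain ⟨ρ, hρ, S, Q, Q', hQ, hc, hp⟩ := hs
    exact (hc.eval_iff v).2 (S.eval_mono v (h𝒮 ρ hρ v Q Q' hQ) ((hp.eval_iff v).1 ih))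

theorem Rule.switch_sound : (Rule.switch (α := α)).Sound := by
  rintro v _ _ ⟨U, R, T⟩
  simp only [Structure.eval]
  tauto

theorem Rule.restrictedSwitch_sound (c : Set Restriction) :
    (Rule.restrictedSwitch (α := α) c).Sound := by
  rintro v _ _ ⟨U, R, T, -⟩
  exact Rule.switch_sound v _ _ ⟨U, R, T⟩

theorem KSreplace_sound {ρ : Rule α} (hρ : ρ.Sound) : ∀ σ ∈ KSreplace ρ, σ.Sound := by
  rintro σ (rfl | rfl | rfl | rfl | rfl | rfl | rfl | rfl)
  case inr.inl => exact hρ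
  all_goals
    rintro v _ _ ⟨⟩
    simp only [Structure.eval]
    tauto

/-! ### Derivability in `KSdli` -/

/-- `T` is derivable from `R` by bottom-up rule instances of `KSdli`. -/
def Der (R T : Structure α) : Prop :=
  Relation.ReflTransGen (Step (KSdli α)) R T

theorem Step.of_rule {𝒮 : System α} {ρ : Rule α} (hρ : ρ ∈ 𝒮) {R T Q Q' : Structure α}
    (h : ρ Q Q') (hR : Congr R Q) (hT : Congr T Q') : Step 𝒮 R T :=
  ⟨ρ, hρ, .hole, Q, Q', h, hR, hT⟩

theorem Step.disj_left {𝒮 : System α} {R T : Structure α} (h : Step 𝒮 R T) (U : Structure α) :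
    Step 𝒮 (disj R U) (disj T U) := by
  obtain ⟨ρ, hρ, S, Q, Q', hQ, hc, hp⟩ := h
  exact ⟨ρ, hρ, .disjLeft S U, Q, Q', hQ, .congr_disj hc (.refl _), .congr_disj hp (.refl _)⟩

theorem Step.disj_right {𝒮 : System α} {R T : Structure α} (h : Step 𝒮 R T) (U : Structure α) :
    Step 𝒮 (disj U R) (disj U T) := by
  obtain ⟨ρ, hρ, S, Q, Q', hQ, hc, hp⟩ := h
  exact ⟨ρ, hρ, .disjRight U S, Q, Q', hQ, .congr_disj (.refl _) hc, .congr_disj (.refl _) hp⟩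

theorem Step.conj_left {𝒮 : System α} {R T : Structure α} (h : Step 𝒮 R T) (U : Structure α) :
    Step 𝒮 (conj R U) (conj T U) := by
  obtain ⟨ρ, hρ, S, Q, Q', hQ, hc, hp⟩ := h
  exact ⟨ρ, hρ, .conjLeft S U, Q, Q', hQ, .congr_conj hc (.refl _), .congr_conj hp (.refl _)⟩

namespace Der

theorem refl (R : Structure α) : Der R R := Relation.ReflTransGen.refl

theorem trans {R T U : Structure α} (h₁ : Der R T) (h₂ : Der T U) : Der R U :=
  Relation.ReflTransGen.trans h₁ h₂

theorem disj_left {R T : Structure α} (h : Der R T) (U : Structure α) :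
    Der (disj R U) (disj T U) :=
  Relation.ReflTransGen.lift (disj · U) (fun _ _ hs => hs.disj_left U) _ _ h

theorem disj_right {R T : Structure α} (h : Der R T) (U : Structure α) :
    Der (disj U R) (disj U T) :=
  Relation.ReflTransGen.lift (disj U ·) (fun _ _ hs => hs.disj_right U) _ _ h

theorem conj_left {R T : Structure α} (h : Der R T) (U : Structure α) :
    Der (conj R U) (conj T U) :=
  Relation.ReflTransGen.lift (conj · U) (fun _ _ hs => hs.conj_left U) _ _ h

theorem weak (R : Structure α) : Der R fls :=
  .single (.of_rule (by simp [KSdli, KSreplace]) (Rule.weak.mk R) (.refl _) (.refl _))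

theorem contr (R : Structure α) : Der R (disj R R) :=
  .single (.of_rule (by simp [KSdli, KSreplace]) (Rule.contr.mk R) (.refl _) (.refl _))

theorem ai (a : α) : Der (disj (atom a) (neg (atom a))) tru :=
  .single (.of_rule (by simp [KSdli, KSreplace]) (Rule.ai.mk a) (.refl _) (.refl _))

theorem add_fls (R : Structure α) : Der R (disj R fls) :=
  (contr R).trans ((weak R).disj_right R)

theorem drop_fls (R : Structure α) : Der (disj R fls) R :=
  .single (.of_rule (by simp [KSdli, KSreplace]) (Rule.u1.mk R) (.refl _) (.refl _))

theorem drop_tru (R : Structure α) : Der (conj R tru) R :=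
  .single (.of_rule (by simp [KSdli, KSreplace]) (Rule.u2.mk R) (.refl _) (.refl _))

/-- An empty chain does not absorb `≈`, but every step works modulo `≈`; so a spare `f` is added and
then removed up to congruence. -/
theorem of_congr {R T : Structure α} (h : Congr R T) : Der R T :=
  (add_fls R).trans
    (.single (.of_rule (by simp [KSdli, KSreplace]) (Rule.u1.mk R) (.refl _) h.symm))

theorem drop_right (R T : Structure α) : Der (disj R T) R :=
  ((weak T).disj_right R).trans (drop_fls R)

theorem drop_left (R T : Structure α) : Der (disj R T) T :=
  (of_congr (.disj_comm R T)).trans (drop_right T R)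

theorem tru_conj (R : Structure α) : Der (conj tru R) R :=
  (of_congr (.conj_comm _ _)).trans (drop_tru R)

theorem switch {U R : Structure α} (hd : IsDisj R ∨ IsAtomNe R Atom.tru)
    (hl : IsConj U ∨ IsAtomNe U Atom.fls) (hi : Interact R U) (T : Structure α) :
    Der (disj U (conj R T)) (conj (disj U R) T) := by
  refine .single (.of_rule (ρ := Rule.dlis) (by simp [KSdli, KSreplace])
    (Rule.restrictedSwitch.mk U R T ?_) (.refl _) (.refl _))
  rintro r (rfl | rfl | rfl)
  exacts [hd, hl, hi]

end Der

/-! ### Negation normal forms -/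

/-- Negation normal forms. -/
inductive NForm (α : Type*) where
  | lit : Atom α → NForm α
  | or : NForm α → NForm α → NForm α
  | and : NForm α → NForm α → NForm α

namespace NForm

/-- A negation normal form as a structure. -/
def toStructure : NForm α → Structure α
  | .lit x => x.toStructure
  | .or A B => disj A.toStructure B.toStructure
  | .and A B => conj A.toStructure B.toStructure

/-- The number of nodes of a negation normal form. -/
def size : NForm α → ℕ
  | .lit _ => 1
  | .or A B => A.size + B.size + 1
  | .and A B => A.size + B.size + 1

/-- The truth value of a negation normal form. -/
abbrev eval (v : α → Prop) (A : NForm α) : Prop := A.toStructure.eval v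

/-- Both polarities are carried through the induction, since De Morgan turns the negation of a
compound into negations of its parts. -/
theorem exists_congr (R : Structure α) :
    (∃ A : NForm α, Congr R A.toStructure) ∧ ∃ A : NForm α, Congr (neg R) A.toStructure := by
  induction R with
  | fls => exact ⟨⟨.lit .fls, .refl _⟩, ⟨.lit .tru, .neg_fls⟩⟩
  | tru => exact ⟨⟨.lit .tru, .refl _⟩, ⟨.lit .fls, .neg_tru⟩⟩
  | atom a => exact ⟨⟨.lit (.pos a), .refl _⟩, ⟨.lit (.neg a), .refl _⟩⟩
  | disj R T ihR ihT =>
    obtain ⟨⟨A, hA⟩, ⟨A', hA'⟩⟩ := ihR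
    obtain ⟨⟨B, hB⟩, ⟨B', hB'⟩⟩ := ihT
    exact ⟨⟨.or A B, .congr_disj hA hB⟩,
      ⟨.and A' B', (Congr.neg_disj R T).trans (.congr_conj hA' hB')⟩⟩
  | conj R T ihR ihT =>
    obtain ⟨⟨A, hA⟩, ⟨A', hA'⟩⟩ := ihR
    obtain ⟨⟨B, hB⟩, ⟨B', hB'⟩⟩ := ihT
    exact ⟨⟨.and A B, .congr_conj hA hB⟩,
      ⟨.or A' B', (Congr.neg_conj R T).trans (.congr_disj hA' hB')⟩⟩
  | neg R ih => exact ⟨ih.2, ih.1.imp fun A hA => (Congr.neg_neg R).trans hA⟩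

/-- Truth is monotone in the literals that occur. -/
theorem eval_mono {v w : α → Prop} (A : NForm α)
    (hpos : ∀ a, Atom.pos a ∈ atoms A.toStructure → v a → w a)
    (hneg : ∀ a, Atom.neg a ∈ atoms A.toStructure → w a → v a) (h : A.eval v) : A.eval w := by
  induction A with
  | lit x =>
    cases x with
    | pos a => exact hpos a rfl h
    | neg a => exact fun hw => h (hneg a ⟨.pos a, rfl, rfl⟩ hw)
    | fls => exact h
    | tru => exact h
  | or A B ihA ihB =>
    exact h.imp (ihA (fun a ha => hpos a (.inl ha)) fun a ha => hneg a (.inl ha))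
      (ihB (fun a ha => hpos a (.inr ha)) fun a ha => hneg a (.inr ha))
  | and A B ihA ihB =>
    exact h.imp (ihA (fun a ha => hpos a (.inl ha)) fun a ha => hneg a (.inl ha))
      (ihB (fun a ha => hpos a (.inr ha)) fun a ha => hneg a (.inr ha))

end NForm

/-! ### Lists of negation normal forms, read disjunctively -/

/-- The disjunction of a list of negation normal forms. -/
def bigDisj : List (NForm α) → Structure α
  | [] => fls
  | A :: Γ => disj A.toStructure (bigDisj Γ)

/-- The disjunction of the list is a tautology. -/
def Taut (Γ : List (NForm α)) : Prop := ∀ v : α → Prop, ∃ A ∈ Γ, A.eval v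

/-- The total size of a list of negation normal forms. -/
def listSize (Γ : List (NForm α)) : ℕ := (Γ.map NForm.size).sum

theorem Taut.perm {Γ Δ : List (NForm α)} (h : Γ.Perm Δ) (hΓ : Taut Γ) : Taut Δ :=
  fun v => (hΓ v).imp fun _ hA => ⟨h.mem_iff.1 hA.1, hA.2⟩

theorem listSize_perm {Γ Δ : List (NForm α)} (h : Γ.Perm Δ) : listSize Γ = listSize Δ :=
  (h.map _).sum_eq

theorem congr_disj_left_comm (R T U : Structure α) :
    Congr (disj R (disj T U)) (disj T (disj R U)) :=
  (Congr.disj_assoc R T U).symm.trans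
    ((Congr.congr_disj (.disj_comm R T) (.refl U)).trans (.disj_assoc T R U))

theorem congr_bigDisj {Γ Δ : List (NForm α)} (h : Γ.Perm Δ) :
    Congr (bigDisj Γ) (bigDisj Δ) := by
  induction h with
  | nil => exact .refl _
  | cons A _ ih => exact .congr_disj (.refl _) ih
  | swap A B Γ => exact congr_disj_left_comm _ _ _
  | trans _ _ ih₁ ih₂ => exact ih₁.trans ih₂

/-- The closing `f` of `bigDisj` makes the deepness condition automatic, whatever the members are.
-/
theorem isDisj_or_isAtomNe_bigDisj (Γ : List (NForm α)) :
    IsDisj (bigDisj Γ) ∨ IsAtomNe (bigDisj Γ) Atom.tru := by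
  cases Γ with
  | nil => exact .inr ⟨.fls, by simp, .refl _⟩
  | cons A Γ => exact .inl ⟨_, _, .refl _⟩

theorem atoms_subset_bigDisj {Γ : List (NForm α)} {A : NForm α} (hA : A ∈ Γ) :
    atoms A.toStructure ⊆ atoms (bigDisj Γ) := by
  induction hA with
  | head => exact Set.subset_union_left
  | tail _ _ ih => exact ih.trans Set.subset_union_right

/-- If no member of `Δ` interacts with `Γ`, a tautology `Γ ∨ Δ` splits. -/
theorem exists_interact {Γ Δ : List (NForm α)} (h : Taut (Γ ++ Δ)) (hΓ : ¬ Taut Γ)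
    (hΔ : ¬ Taut Δ) : ∃ U ∈ Δ, Interact (bigDisj Γ) U.toStructure := by
  by_contra! hn
  simp only [Taut, not_forall] at hΓ hΔ
  obtain ⟨v₁, hv₁⟩ := hΓ
  obtain ⟨v₂, hv₂⟩ := hΔ
  push Not at hv₁ hv₂
  have key : ∀ x : Atom α, ∀ A ∈ Γ, ∀ U ∈ Δ, x ∈ atoms A.toStructure →
      x.dual ∉ atoms U.toStructure := fun x A hA U hU hx hx' =>
    hn U hU ⟨x.dual, ⟨x, atoms_subset_bigDisj hA hx, rfl⟩, hx'⟩
  -- The glued valuation makes `a` true only if a side containing the literal `¬a` has it true.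
  -- Without interaction, a member of either side that is true here is true under that side's own
  -- refuting valuation.
  obtain ⟨A, hA, hAv⟩ := h fun a =>
    ((∃ G ∈ Γ, Atom.neg a ∈ atoms G.toStructure) ∧ v₁ a) ∨
      ((∃ H ∈ Δ, Atom.neg a ∈ atoms H.toStructure) ∧ v₂ a)
  rcases List.mem_append.1 hA with hA | hA
  · refine hv₁ A hA (A.eval_mono ?_ ?_ hAv)
    · rintro a ha (h | ⟨⟨H, hH, hneg⟩, -⟩)
      · exact h.2
      · exact absurd hneg (key _ A hA H hH ha)
    · exact fun a ha hv => .inl ⟨⟨A, hA, ha⟩, hv⟩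
  · refine hv₂ A hA (A.eval_mono ?_ ?_ hAv)
    · rintro a ha (⟨⟨G, hG, hneg⟩, -⟩ | h)
      · exact absurd ha (key _ G hG A hA hneg)
      · exact h.2
    · exact fun a ha hv => .inr ⟨⟨A, hA, ha⟩, hv⟩

theorem not_taut_of_cons {Γ : List (NForm α)} {A : NForm α} (h : ¬ Taut (A :: Γ)) : ¬ Taut Γ :=
  fun hΓ => h fun v => (hΓ v).imp fun _ hB => ⟨List.mem_cons_of_mem _ hB.1, hB.2⟩

/-- The part of `Δ` that is needed to prove `Γ` is switched into the conjunct `Γ`, one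
interacting member at a time. -/
theorem Der.absorb (X : Structure α) (n : ℕ) : ∀ Γ Δ : List (NForm α), Δ.length = n →
    Taut (Γ ++ Δ) → ¬ Taut Δ → (∀ A B, NForm.or A B ∉ Δ) →
    (∀ Λ : List (NForm α), Taut Λ → listSize Λ ≤ listSize Γ + listSize Δ →
      Der (bigDisj Λ) tru) →
    Der (disj (conj (bigDisj Γ) X) (bigDisj Δ)) X := by
  induction n with
  | zero =>
    intro Γ Δ hn ht _ _ hp
    obtain rfl := List.length_eq_zero_iff.1 hn
    rw [List.append_nil] at ht
    exact (drop_right _ _).trans (((hp Γ ht (Nat.le_add_right _ _)).conj_left X).trans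
      (tru_conj X))
  | succ n ih =>
    intro Γ Δ hn ht hΔ hor hp
    by_cases hΓ : Taut Γ
    · exact (drop_right _ _).trans (((hp Γ hΓ (Nat.le_add_right _ _)).conj_left X).trans
        (tru_conj X))
    obtain ⟨U, hU, hi⟩ := exists_interact ht hΓ hΔ
    obtain ⟨Δ', hperm⟩ : ∃ Δ', Δ.Perm (U :: Δ') := by
      obtain ⟨s, t, rfl⟩ := List.append_of_mem hU
      exact ⟨s ++ t, List.perm_middle⟩
    have hsize : listSize Δ = U.size + listSize Δ' := by
      rw [listSize_perm hperm]
      simp [listSize]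
    have hlen : Δ'.length = n := by
      have := hperm.length_eq
      simp only [List.length_cons] at this
      omega
    have hΔ' : ¬ Taut Δ' := not_taut_of_cons fun h => hΔ (h.perm hperm.symm)
    have hor' : ∀ A B, NForm.or A B ∉ Δ' := fun A B h =>
      hor A B (hperm.mem_iff.2 (List.mem_cons_of_mem _ h))
    refine ((of_congr (congr_bigDisj hperm)).disj_right _).trans ?_
    -- Laziness forbids switching in `f`; it can be discarded, being never true.
    by_cases hf : U = .lit .fls
    · subst hf
      refine ((drop_left _ _).disj_right _).trans (ih Γ Δ' hlen ?_ hΔ' hor' ?_)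
      · intro v
        obtain ⟨A, hA, hv⟩ := ht v
        rcases List.mem_append.1 hA with hA | hA
        · exact ⟨A, List.mem_append_left _ hA, hv⟩
        · rcases List.mem_cons.1 (hperm.mem_iff.1 hA) with rfl | hA
          · exact hv.elim
          · exact ⟨A, List.mem_append_right _ hA, hv⟩
      · exact fun Λ hΛ hs => hp Λ hΛ (by omega)
    · have hlazy : IsConj U.toStructure ∨ IsAtomNe U.toStructure Atom.fls := by
        cases U with
        | lit x => exact .inr ⟨x, fun hx => hf (hx ▸ rfl), .refl _⟩
        | or A B => exact absurd hU (hor A B)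
        | and A B => exact .inl ⟨_, _, .refl _⟩
      refine (of_congr ((Congr.disj_assoc _ _ _).symm.trans
        (.congr_disj (.disj_comm _ _) (.refl _)))).trans ?_
      refine ((switch (isDisj_or_isAtomNe_bigDisj Γ) hlazy hi X).disj_left _).trans ?_
      -- Moving `U` across leaves the total size unchanged, so the size bound in `hp` survives.
      refine ih (U :: Γ) Δ' hlen ?_ hΔ' hor' ?_
      · exact ht.perm ((hperm.append_left Γ).trans List.perm_middle)
      · refine fun Λ hΛ hs => hp Λ hΛ ?_
        simp only [listSize, List.map_cons, List.sum_cons] at hs hsize ⊢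
        omega

/-! ### Completeness of `KSdli` -/

theorem Der.of_literals {Γ : List (NForm α)} (h : Taut Γ)
    (hlit : ∀ A ∈ Γ, ∃ x, A = NForm.lit x) : Der (bigDisj Γ) tru := by
  by_cases ht : NForm.lit Atom.tru ∈ Γ
  · obtain ⟨s, t, rfl⟩ := List.append_of_mem ht
    exact (of_congr (congr_bigDisj List.perm_middle)).trans (drop_right _ _)
  -- This valuation falsifies every negative literal of `Γ`, so the true member is some `a` whose
  -- negation also occurs.
  obtain ⟨A, hA, hv⟩ := h fun a => NForm.lit (Atom.neg a) ∈ Γ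
  obtain ⟨x, rfl⟩ := hlit A hA
  cases x with
  | pos a =>
    obtain ⟨s, t, rfl⟩ := List.append_of_mem hA
    have hm : NForm.lit (Atom.neg a) ∈ s ++ t := by
      have : NForm.lit (Atom.neg a) ∈ s ++ NForm.lit (Atom.pos a) :: t := hv
      simpa using this
    obtain ⟨s', t', hst⟩ := List.append_of_mem hm
    have hperm : (s ++ NForm.lit (Atom.pos a) :: t).Perm
        (NForm.lit (Atom.pos a) :: NForm.lit (Atom.neg a) :: (s' ++ t')) :=
      List.perm_middle.trans (.cons _ (hst ▸ List.perm_middle))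
    refine (of_congr ((congr_bigDisj hperm).trans (Congr.disj_assoc _ _ _).symm)).trans ?_
    exact (drop_right _ _).trans (ai a)
  | neg a => exact absurd hA hv
  | fls => exact hv.elim
  | tru => exact absurd hA ht

theorem Der.of_taut (n : ℕ) : ∀ Γ : List (NForm α), listSize Γ < n → Taut Γ →
    Der (bigDisj Γ) tru := by
  induction n with
  | zero => exact fun _ h => absurd h (Nat.not_lt_zero _)
  | succ n ih =>
    intro Γ hn ht
    by_cases hor : ∃ A B, NForm.or A B ∈ Γ
    · obtain ⟨A, B, hm⟩ := hor
      obtain ⟨s, t, rfl⟩ := List.append_of_mem hm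
      have hperm : (s ++ NForm.or A B :: t).Perm (NForm.or A B :: (s ++ t)) := List.perm_middle
      refine (of_congr ((congr_bigDisj hperm).trans (.disj_assoc _ _ _))).trans
        (ih (A :: B :: (s ++ t)) ?_ ?_)
      · rw [listSize_perm hperm] at hn
        simp only [listSize, List.map_cons, List.sum_cons, NForm.size] at hn ⊢
        omega
      · intro v
        obtain ⟨C, hC, hv⟩ := ht.perm hperm v
        rcases List.mem_cons.1 hC with rfl | hC
        · rcases hv with hv | hv
          · exact ⟨A, by simp, hv⟩
          · exact ⟨B, by simp, hv⟩
        · exact ⟨C, by simp [List.mem_append.1 hC], hv⟩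
    push Not at hor
    by_cases hand : ∃ A B, NForm.and A B ∈ Γ
    · obtain ⟨A, B, hm⟩ := hand
      obtain ⟨s, t, rfl⟩ := List.append_of_mem hm
      have hperm : (s ++ NForm.and A B :: t).Perm (NForm.and A B :: (s ++ t)) :=
        List.perm_middle
      have hor' : ∀ A B, NForm.or A B ∉ s ++ t := fun C D h =>
        hor C D (hperm.mem_iff.2 (List.mem_cons_of_mem _ h))
      refine (of_congr (congr_bigDisj hperm)).trans ?_
      rw [listSize_perm hperm] at hn
      replace ht := ht.perm hperm
      clear hm hor hperm
      generalize s ++ t = Δ at *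
      have hA : Taut (A :: Δ) := by
        intro v
        obtain ⟨C, hC, hv⟩ := ht v
        rcases List.mem_cons.1 hC with rfl | hC
        · exact ⟨A, by simp, hv.1⟩
        · exact ⟨C, by simp [hC], hv⟩
      have hB : Taut (B :: Δ) := by
        intro v
        obtain ⟨C, hC, hv⟩ := ht v
        rcases List.mem_cons.1 hC with rfl | hC
        · exact ⟨B, by simp, hv.2⟩
        · exact ⟨C, by simp [hC], hv⟩
      simp only [listSize, List.map_cons, List.sum_cons, NForm.size] at hn
      by_cases hΔ : Taut Δ
      · exact (drop_left _ _).trans (ih Δ (by simp only [listSize]; omega) hΔ)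
      · refine ((contr _).disj_right _).trans ((of_congr (Congr.disj_assoc _ _ _).symm).trans ?_)
        refine Der.trans (disj_left ?_ _)
          (ih (B :: Δ) (by simp only [listSize, List.map_cons, List.sum_cons]; omega) hB)
        -- Adding `f` turns `A` into `bigDisj [A]`. The lists to be proved inside `absorb` are
        -- smaller than the original because `B` and the conjunction node are left out.
        refine (((add_fls A.toStructure).conj_left _).disj_left _).trans
          (absorb B.toStructure _ [A] Δ rfl hA hΔ hor' fun Λ hΛ hs => ih Λ ?_ hΛ)
        simp only [listSize, List.map_cons, List.map_nil, List.sum_cons, List.sum_nil] at hs ⊢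
        omega
    · push Not at hand
      refine of_literals ht fun A hA => ?_
      cases A with
      | lit x => exact ⟨x, rfl⟩
      | or A B => exact absurd hA (hor A B)
      | and A B => exact absurd hA (hand A B)

theorem KSdli_complete {R : Structure α} (h : ∀ v : α → Prop, R.eval v) :
    Proves (KSdli α) R := by
  obtain ⟨A, hA⟩ := (NForm.exists_congr R).1
  refine ⟨tru, ?_, .refl _⟩
  refine (Der.of_congr hA).trans ((Der.add_fls _).trans
    (Der.of_taut _ [A] (Nat.lt_succ_self _) fun v => ⟨A, by simp, (hA.eval_iff v).1 (h v)⟩))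

/-! ### Comparison of the systems -/

theorem Proves.mono {ρ ρ' : Rule α} (hρ : ∀ Q Q', ρ Q Q' → ρ' Q Q') {R : Structure α}
    (h : Proves (KSreplace ρ) R) : Proves (KSreplace ρ') R := by
  obtain ⟨T, hRT, hT⟩ := h
  refine ⟨T, Relation.ReflTransGen.mono ?_ _ _ hRT, hT⟩
  rintro P P' ⟨σ, hσ, S, Q, Q', hQ, hc, hp⟩
  rcases hσ with h | rfl | h
  · exact ⟨σ, .inl h, S, Q, Q', hQ, hc, hp⟩
  · exact ⟨ρ', .inr (.inl rfl), S, Q, Q', hρ Q Q' hQ, hc, hp⟩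
  · exact ⟨σ, .inr (.inr h), S, Q, Q', hQ, hc, hp⟩

theorem KSreplace_proves_iff {ρ : Rule α} (hs : ρ.Sound)
    (hρ : ∀ Q Q', Rule.dlis Q Q' → ρ Q Q') (R : Structure α) :
    Proves (KSreplace ρ) R ↔ ∀ v : α → Prop, R.eval v :=
  ⟨fun h => h.eval (KSreplace_sound hs), fun h => (KSdli_complete h).mono hρ⟩

theorem KSreplace_restrictedSwitch_proves_iff (c : Set Restriction) (R : Structure α) :
    Proves (KSreplace (Rule.restrictedSwitch c)) R ↔ ∀ v : α → Prop, R.eval v := by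
  refine KSreplace_proves_iff (Rule.restrictedSwitch_sound c) ?_ R
  rintro _ _ ⟨U, R, T, h⟩
  -- `dlis` imposes every restriction there is, hence all those in `c`.
  exact ⟨U, R, T, fun r _ => h r (by cases r <;> simp)⟩

theorem KSu_proves_iff (R : Structure α) :
    Proves (KSu α) R ↔ ∀ v : α → Prop, R.eval v := by
  refine KSreplace_proves_iff Rule.switch_sound ?_ R
  rintro _ _ ⟨U, R, T, -⟩
  exact ⟨U, R, T⟩

theorem KSfamily_proves_iff {𝒮 : System α} (h : 𝒮 ∈ KSfamily α) (R : Structure α) :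
    Proves 𝒮 R ↔ ∀ v : α → Prop, R.eval v := by
  rcases h with rfl | rfl | rfl | rfl | rfl | rfl | rfl | rfl
  · exact KSu_proves_iff R
  all_goals exact KSreplace_restrictedSwitch_proves_iff _ R

end KS

theorem mainTheorem6 (α : Type*) :
    KS.Equivalent (KS.KSu α) (KS.KSdli α) ∧
      ∀ 𝒮 ∈ KS.KSfamily α, ∀ 𝒮' ∈ KS.KSfamily α, KS.Equivalent 𝒮 𝒮' := by
  have key : ∀ 𝒮 ∈ KS.KSfamily α, ∀ 𝒮' ∈ KS.KSfamily α, KS.Equivalent 𝒮 𝒮' :=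
    fun 𝒮 h 𝒮' h' R =>
      (KS.KSfamily_proves_iff h R).trans (KS.KSfamily_proves_iff h' R).symm
  exact ⟨key _ (by simp [KS.KSfamily]) _ (by simp [KS.KSfamily]), key⟩
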